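/- Let $K\subset\mathbb R^n$ be a convex body (a compact convex set with non-empty interior), and let $\|\cdot\|$ be the norm on $\mathbb R^n$ whose unit ball is $K-K=\{a-b : a,b\in K\}$. Let $f\colon K\to Y$ be a continuous map to a Hausdorff topological space $Y$ of covering dimension less than $n$, i.e. every finite open cover of $Y$ has a finite open refinement such that each point of $Y$ lies in at most $n$ of its members. Then there is a point $y\in Y$ such that the total length of the fiber $f^{-1}(y)$ in the norm $\|\cdot\|$, i.e. its one-dimensional Hausdorff measure with respect to the metric $\|x-x'\|$ (normalized so that a segment $[x,x']$ has length $\|x-x'\|$), is at least $1$. -/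

import Mathlib

open Set
open scoped Pointwise ENNReal

/-- The covering dimension of `Y` is less than `n`: every finite open cover `U` of `Y` has a
finite open refinement `W` such that every point of `Y` lies in at most `n` members of `W`.
(With `n = d + 1` this is the usual `dim Y ≤ d`; for `n = 0` it says that `Y` is empty.) -/
def CoveringDimLT (Y : Type*) [TopologicalSpace Y] (n : ℕ) : Prop :=
  ∀ U : Set (Set Y), U.Finite → (∀ u ∈ U, IsOpen u) → ⋃₀ U = univ →
    ∃ W : Set (Set Y), W.Finite ∧ (∀ w ∈ W, IsOpen w) ∧ ⋃₀ W = univ ∧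
      (∀ w ∈ W, ∃ u ∈ U, w ⊆ u) ∧ ∀ y : Y, {w ∈ W | y ∈ w}.encard ≤ n

/-- The diameter of `s` in the norm with unit ball `B`, that is, with norm `gauge B`. -/
noncomputable def gaugeDiam {V : Type*} [AddCommGroup V] [Module ℝ V] (B s : Set V) : ℝ≥0∞ :=
  ⨆ x ∈ s, ⨆ y ∈ s, ENNReal.ofReal (gauge B (x - y))

/-- The total length of an arbitrary set `s` in the norm with unit ball `B`: its one-dimensional
Hausdorff (outer) measure for the metric `gauge B (x - y)`, normalized so that a segment `[x, y]`
has length `gauge B (x - y)`. -/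
noncomputable def gaugeLength {V : Type*} [AddCommGroup V] [Module ℝ V] (B s : Set V) : ℝ≥0∞ :=
  ⨆ (r : ℝ≥0∞) (_ : 0 < r),
    ⨅ (t : ℕ → Set V) (_ : s ⊆ ⋃ i, t i) (_ : ∀ i, gaugeDiam B (t i) ≤ r), ∑' i, gaugeDiam B (t i)

/-!
# A long fiber of a map from a convex body to a space of smaller dimension

Suppose that every fiber of `f` has length less than one in the norm with unit ball `K - K`. The
contradiction comes from two facts.

*Short connected sets fit in a smaller copy of `K`.* A segment of length `d` is a vector
`d • (u - v)` with `u, v ∈ K`, so attaching it to a set contained in a translate of `a • K` gives a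
set contained in a translate of `(a + d) • K` (`FitsIn.insert`). Hence a tree of total length `a`
fits in a copy of `a • K`. Cover a fiber by open sets of tiny diameter with sum of diameters less
than one, and group them into clusters, the connected components of the intersection graph. Given
`n + 1` points of a cluster, a tree of polygonal paths through successively intersecting sets joins
them, and it enters a set twice at most `n + 1` times, so its length is almost bounded by the sum
of the diameters. Helly's theorem turns this into an enclosing copy of the whole cluster
(`fitsIn_cluster`). Thus a neighborhood of each fiber is a finite disjoint union of open sets that
fit in a smaller copy of `K` (`exists_disjoint_cover_of_gaugeLength_lt_one`). By compactness and
the hypothesis on `Y`, `K` is covered by finitely many such sets with multiplicity at most `n`.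

*Such a cover does not exist* (`exists_finrank_lt_encard_of_cover`). After a translation the
origin is interior to `K`. Let the `i`-th set lie in `t i + lam • K` with `lam < 1`, let `φ i` be
a smooth partition of unity subordinate to the cover, and let `ρ = ∑ φ i • t i`. Multiplicity at
most `n` makes the Jacobian of `ρ` vanish inside `K`, while `x - ρ x ∈ lam • K` allows one to
interpolate between `ρ` and the identity near the boundary of `K` without meeting a neighborhood
of the origin. The resulting smooth map is the identity outside `K` and its Jacobian vanishes
wherever the map is near the origin. This contradicts the positivity of its degree, in the form of
`exists_norm_lt_and_det_ne_zero`. That theorem is proved in the manner of Milnor and Rogers: for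
the maps `x ↦ x + t • g x` the change of variables formula holds for small `t`, and for polynomial
integrands it is an identity between polynomials in `t`, hence holds for `t = 1`.
-/

/-! ### Sets contained in a translate of a multiple of a convex set -/

/-- `FitsIn K a S` means that `S` is contained in a translate of `a • K`. -/
def FitsIn {V : Type*} [AddCommGroup V] [Module ℝ V] (K : Set V) (a : ℝ) (S : Set V) : Prop :=
  ∃ t : V, ∀ x ∈ S, ∃ k ∈ K, x = t + a • k

namespace FitsIn

variable {V : Type*} [AddCommGroup V] [Module ℝ V] {K : Set V} {a b : ℝ} {S T : Set V}

lemma subset (h : FitsIn K a S) (hT : T ⊆ S) : FitsIn K a T := by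
  obtain ⟨t, ht⟩ := h
  exact ⟨t, fun x hx => ht x (hT hx)⟩

lemma singleton (hK : K.Nonempty) (a : ℝ) (x : V) : FitsIn K a {x} := by
  obtain ⟨k, hk⟩ := hK
  refine ⟨x - a • k, ?_⟩
  rintro y rfl
  exact ⟨k, hk, by abel⟩

/-- Attaching to a point of `S` a segment of length at most `d`, in the norm with unit ball
`K - K`, costs at most `d` in the size of the enclosing copy of `K`. -/
lemma insert (hK : Convex ℝ K) (ha : 0 ≤ a) {d : ℝ} (hd : 0 ≤ d) (h : FitsIn K a S)
    {p x u v : V} (hp : p ∈ S) (hu : u ∈ K) (hv : v ∈ K) (hx : x - p = d • (u - v)) :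
    FitsIn K (a + d) (insert x S) := by
  obtain ⟨t, ht⟩ := h
  -- If `p = t + a k` then `x = (t - d v) + (a k + d u)`, and `t + a k' = (t - d v) + (a k' + d v)`.
  refine ⟨t - d • v, ?_⟩
  have key : ∀ k ∈ K, ∀ w ∈ K, ∃ z ∈ K, t - d • v + (a + d) • z = t + a • k + d • (w - v) := by
    intro k hk w hw
    obtain ⟨z, hz, hz'⟩ := hK.exists_mem_add_smul_eq hk hw ha hd
    refine ⟨z, hz, ?_⟩
    rw [hz', smul_sub]
    abel
  rintro y (rfl | hy)
  · obtain ⟨k, hk, hk'⟩ := ht p hp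
    obtain ⟨z, hz, hz'⟩ := key k hk u hu
    exact ⟨z, hz, by rw [hz', ← hk', ← hx]; abel⟩
  · obtain ⟨k, hk, hk'⟩ := ht y hy
    obtain ⟨z, hz, hz'⟩ := key k hk v hv
    exact ⟨z, hz, by rw [hz', hk']; simp⟩

lemma mono (hK : Convex ℝ K) (hne : K.Nonempty) (ha : 0 ≤ a) (hab : a ≤ b) (h : FitsIn K a S) :
    FitsIn K b S := by
  rcases S.eq_empty_or_nonempty with rfl | ⟨p, hp⟩
  · exact ⟨0, by simp⟩
  obtain ⟨k, hk⟩ := hne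
  obtain ⟨t, ht⟩ := h
  refine ⟨t - (b - a) • k, fun x hx => ?_⟩
  obtain ⟨l, hl, rfl⟩ := ht x hx
  obtain ⟨z, hz, hz'⟩ := hK.exists_mem_add_smul_eq hl hk ha (sub_nonneg.2 hab)
  refine ⟨z, hz, ?_⟩
  rw [show b = a + (b - a) by ring, hz']
  simp

end FitsIn

/-! ### Clusters of small sets -/

/-- One step in the construction of a short tree through given points. The set `P` holds the
vertices of a tree that has visited the sets `U i`, `i ∈ T`; a path in the intersection graph from
`s` to `T` extends it to a tree reaching a given point of `U s`. Each newly visited set `U i` costs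
`d i`, as it is entered for the first time; only the set where the new branch meets the old tree is
paid for twice, and this costs at most `r`. -/
lemma exists_extend_tree {V ι : Type*} [AddCommGroup V] [Module ℝ V] [DecidableEq ι] {K : Set V}
    (hK : Convex ℝ K) {U : ι → Set V} {d : ι → ℝ} {r : ℝ} (hd : ∀ i, 0 ≤ d i) (hdr : ∀ i, d i ≤ r)
    (hU : ∀ i, ∀ x ∈ U i, ∀ y ∈ U i, ∃ u ∈ K, ∃ v ∈ K, x - y = d i • (u - v))
    {G : SimpleGraph ι} (hG : ∀ i j, G.Adj i j → (U i ∩ U j).Nonempty)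
    {T : Finset ι} {P : Set V} {m : ℕ} (hTP : ∀ i ∈ T, (P ∩ U i).Nonempty)
    (hP : FitsIn K (∑ i ∈ T, d i + m * r) P) {s v : ι} (p : G.Walk s v) (hp : p.IsPath)
    (hv : v ∈ T) {x : V} (hx : x ∈ U s) :
    ∃ (T' : Finset ι) (P' : Set V), T ⊆ T' ∧ (∀ i ∈ T', i ∈ T ∨ i ∈ p.support) ∧ P ⊆ P' ∧ x ∈ P' ∧
      (∀ i ∈ T', (P' ∩ U i).Nonempty) ∧ FitsIn K (∑ i ∈ T', d i + (m + 1 : ℕ) * r) P' := by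
  have base : ∀ s ∈ T, ∀ x ∈ U s, ∃ P' : Set V, P ⊆ P' ∧ x ∈ P' ∧
      (∀ i ∈ T, (P' ∩ U i).Nonempty) ∧ FitsIn K (∑ i ∈ T, d i + (m + 1 : ℕ) * r) P' := by
    intro s hs x hx
    obtain ⟨q, hqP, hqU⟩ := hTP s hs
    obtain ⟨u, hu, v, hv, h⟩ := hU s x hx q hqU
    have h0 : 0 ≤ ∑ i ∈ T, d i + m * r :=
      add_nonneg (Finset.sum_nonneg fun i _ => hd i)
        (mul_nonneg m.cast_nonneg ((hd s).trans (hdr s)))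
    refine ⟨insert x P, subset_insert _ _, mem_insert _ _,
      fun i hi => (hTP i hi).mono (inter_subset_inter_left _ (subset_insert _ _)),
      (hP.insert hK h0 (hd s) hqP hu hv h).mono hK ⟨u, hu⟩ (add_nonneg h0 (hd s)) ?_⟩
    push_cast
    linarith [hdr s]
  induction p generalizing x with
  | nil =>
    obtain ⟨P', h1, h2, h3, h4⟩ := base _ hv x hx
    exact ⟨T, P', subset_rfl, fun i hi => Or.inl hi, h1, h2, h3, h4⟩
  | @cons s w v hadj p ih =>
    by_cases hs : s ∈ T
    · obtain ⟨P', h1, h2, h3, h4⟩ := base _ hs x hx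
      exact ⟨T, P', subset_rfl, fun i hi => Or.inl hi, h1, h2, h3, h4⟩
    rw [SimpleGraph.Walk.cons_isPath_iff] at hp
    obtain ⟨q, hqs, hqw⟩ := hG s w hadj
    obtain ⟨T', P', hT, hT', hPP, hqP, hne, hfit⟩ := ih hp.1 hv hqw
    have hsT' : s ∉ T' := fun h => (hT' s h).elim hs hp.2
    obtain ⟨u, hu, v, hv, h⟩ := hU s x hx q hqs
    have h0 : 0 ≤ ∑ i ∈ T', d i + (m + 1 : ℕ) * r :=
      add_nonneg (Finset.sum_nonneg fun i _ => hd i)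
        (mul_nonneg (Nat.cast_nonneg _) ((hd s).trans (hdr s)))
    refine ⟨insert s T', insert x P', hT.trans (Finset.subset_insert _ _), ?_,
      hPP.trans (subset_insert _ _), mem_insert _ _, ?_, ?_⟩
    · intro i hi
      rw [SimpleGraph.Walk.support_cons, List.mem_cons]
      rcases Finset.mem_insert.1 hi with rfl | hi
      · exact Or.inr (Or.inl rfl)
      · exact (hT' i hi).imp id Or.inr
    · intro i hi
      rcases Finset.mem_insert.1 hi with rfl | hi
      · exact ⟨x, mem_insert _ _, hx⟩
      · exact (hne i hi).mono (inter_subset_inter_left _ (subset_insert _ _))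
    · rw [Finset.sum_insert hsT', add_assoc, add_comm]
      exact hfit.insert hK h0 (hd s) hqP hu hv h

/-- A connected cluster of sets of small diameter lies in a copy of `K` whose size is the sum of
the diameters, up to an error of `finrank + 1` times the largest diameter: by Helly's theorem
only `finrank + 1` points have to be enclosed at a time, and a tree through these has few
branching points. -/
lemma fitsIn_cluster {V ι : Type*} [NormedAddCommGroup V] [NormedSpace ℝ V]
    [FiniteDimensional ℝ V] [Fintype ι] {K : Set V} (hK : Convex ℝ K) (hKc : IsCompact K)
    {U : ι → Set V} {d : ι → ℝ} {r : ℝ} (hd : ∀ i, 0 ≤ d i) (hdr : ∀ i, d i ≤ r)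
    (hU : ∀ i, ∀ x ∈ U i, ∀ y ∈ U i, ∃ u ∈ K, ∃ v ∈ K, x - y = d i • (u - v))
    {G : SimpleGraph ι} (hG : ∀ i j, G.Adj i j → (U i ∩ U j).Nonempty) (c : G.ConnectedComponent) :
    FitsIn K (∑ i, d i + (Module.finrank ℝ V + 1 : ℕ) * r)
      (⋃ i ∈ {i | G.connectedComponentMk i = c}, U i) := by
  classical
  set C : Set V := ⋃ i ∈ {i | G.connectedComponentMk i = c}, U i with hC
  rcases C.eq_empty_or_nonempty with h | ⟨x₀, hx₀⟩
  · rw [h]; exact ⟨0, by simp⟩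
  have hmem : ∀ x ∈ C, ∃ i, G.connectedComponentMk i = c ∧ x ∈ U i := by
    intro x hx
    simpa [hC] using hx
  obtain ⟨i₀, hi₀, hx₀⟩ := hmem x₀ hx₀
  have hKne : K.Nonempty := by
    obtain ⟨u, hu, -⟩ := hU i₀ x₀ hx₀ x₀ hx₀
    exact ⟨u, hu⟩
  have hr : 0 ≤ r := (hd i₀).trans (hdr i₀)
  have tree : ∀ A : Finset V, (∀ x ∈ A, x ∈ C) → ∃ (T : Finset ι) (P : Set V), i₀ ∈ T ∧
      (∀ x ∈ A, x ∈ P) ∧ (∀ i ∈ T, (P ∩ U i).Nonempty) ∧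
      FitsIn K (∑ i ∈ T, d i + (A.card : ℕ) * r) P := by
    intro A
    induction A using Finset.induction_on with
    | empty =>
      intro _
      exact ⟨{i₀}, {x₀}, by simp, by simp, by simpa using hx₀, FitsIn.singleton hKne _ _⟩
    | insert x A hxA ih =>
      intro hA
      obtain ⟨T, P, h0, hAP, hne, hfit⟩ := ih fun y hy => hA y (Finset.mem_insert_of_mem hy)
      obtain ⟨i, hi, hxi⟩ := hmem x (hA x (Finset.mem_insert_self _ _))
      have hreach : G.Reachable i i₀ := SimpleGraph.ConnectedComponent.eq.1 (hi.trans hi₀.symm)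
      obtain ⟨p, hp⟩ := hreach.exists_isPath
      obtain ⟨T', P', hT, -, hPP, hxP, hne', hfit'⟩ :=
        exists_extend_tree hK hd hdr hU hG hne hfit p hp h0 hxi
      refine ⟨T', P', hT h0, ?_, hne', ?_⟩
      · intro y hy
        rcases Finset.mem_insert.1 hy with rfl | hy
        · exact hxP
        · exact hPP (hAP y hy)
      · rwa [Finset.card_insert_of_notMem hxA]
  set Λ : ℝ := ∑ i, d i + (Module.finrank ℝ V + 1 : ℕ) * r with hΛ
  have helly : (⋂ x : C, (fun k => (x : V) - Λ • k) '' K).Nonempty := by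
    refine Convex.helly_theorem_compact' (𝕜 := ℝ) (fun x => ?_) (fun x => ?_) (fun I hI => ?_)
    · have : (fun k => (x : V) - Λ • k) '' K = (fun z => (x : V) + z) '' ((-Λ) • K) := by
        rw [← image_smul, image_image]
        simp [sub_eq_add_neg]
      rw [this]
      exact (hK.smul _).translate _
    · exact hKc.image (by fun_prop)
    · obtain ⟨T, P, -, hAP, -, hfit⟩ := tree (I.image Subtype.val) (by simp +contextual)
      have hcard : (I.image Subtype.val).card ≤ Module.finrank ℝ V + 1 :=
        Finset.card_image_le.trans hI
      obtain ⟨t, ht⟩ : FitsIn K Λ P := by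
        refine hfit.mono hK hKne (add_nonneg (Finset.sum_nonneg fun i _ => hd i)
          (mul_nonneg (Nat.cast_nonneg _) hr)) (add_le_add ?_ ?_)
        · exact Finset.sum_le_univ_sum_of_nonneg hd
        · exact mul_le_mul_of_nonneg_right (by exact_mod_cast hcard) hr
      refine ⟨t, ?_⟩
      simp only [mem_iInter]
      intro x hx
      obtain ⟨k, hk, h⟩ := ht x (hAP x (Finset.mem_image_of_mem _ hx))
      exact ⟨k, hk, by rw [h]; simp⟩
  obtain ⟨t, ht⟩ := helly
  refine ⟨t, fun x hx => ?_⟩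
  obtain ⟨k, hk, h⟩ := mem_iInter.1 ht ⟨x, hx⟩
  exact ⟨k, hk, by rw [← h]; simp⟩

/-! ### Change of variables for maps that are the identity outside a ball -/

open MeasureTheory Polynomial in
/-- If the integral of a family of polynomials in `t` of bounded degree is constant for small
`t > 0`, then it is constant: by Lagrange interpolation the value at any `t` is a combination,
with coefficients of sum one, of values at small nodes. -/
lemma integral_eval_eq_of_forall_small {α : Type*} [MeasurableSpace α] {μ : Measure α}
    {p : α → ℝ[X]} {N : ℕ} (hp : ∀ x, (p x).natDegree ≤ N)
    (hint : ∀ t : ℝ, Integrable (fun x => (p x).eval t) μ) {ε c : ℝ} (hε : 0 < ε)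
    (hc : ∀ t, 0 < t → t < ε → ∫ x, (p x).eval t ∂μ = c) (t : ℝ) :
    ∫ x, (p x).eval t ∂μ = c := by
  set v : ℕ → ℝ := fun j => ε / (j + 2) with hv
  have hvpos : ∀ j, 0 < v j := fun j => by positivity
  have hvlt : ∀ j, v j < ε := fun j => by
    have : (0 : ℝ) ≤ j := j.cast_nonneg
    exact div_lt_self hε (by linarith)
  have hinj : Set.InjOn v (Finset.range (N + 1)) := by
    intro i _ j _ hij
    have hi : (0 : ℝ) < i + 2 := by positivity
    have hj : (0 : ℝ) < j + 2 := by positivity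
    simp only [hv] at hij
    rw [div_eq_div_iff hi.ne' hj.ne', mul_right_inj' hε.ne'] at hij
    exact_mod_cast (add_right_cancel hij).symm
  set B := fun j => Lagrange.basis (Finset.range (N + 1)) v j
  have hsum : ∀ x, (p x).eval t =
      ∑ j ∈ Finset.range (N + 1), (p x).eval (v j) * (B j).eval t := by
    intro x
    have hdeg : (p x).degree < (Finset.range (N + 1)).card := by
      rw [Finset.card_range]
      exact degree_le_natDegree.trans_lt (by exact_mod_cast Nat.lt_succ_of_le (hp x))
    conv_lhs => rw [Lagrange.eq_interpolate hinj hdeg, Lagrange.interpolate_apply]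
    simp [eval_finsetSum, B]
  simp_rw [hsum]
  rw [integral_finsetSum _ fun j _ => (hint (v j)).mul_const _]
  simp_rw [integral_mul_const]
  rw [Finset.sum_congr rfl fun j _ => by rw [hc (v j) (hvpos j) (hvlt j)], ← Finset.mul_sum,
    ← eval_finsetSum, Lagrange.sum_basis hinj (by simp)]
  simp

open Polynomial in
lemma exists_polynomial_det_id_add_smul {E : Type*} [NormedAddCommGroup E] [NormedSpace ℝ E]
    [FiniteDimensional ℝ E] (A : E →L[ℝ] E) :
    ∃ p : ℝ[X], p.natDegree ≤ Module.finrank ℝ E ∧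
      ∀ t : ℝ, p.eval t = (ContinuousLinearMap.id ℝ E + t • A).det := by
  classical
  set b := Module.finBasis ℝ E
  set M := LinearMap.toMatrix b b (A : E →ₗ[ℝ] E) with hM
  refine ⟨Matrix.det ((X : ℝ[X]) • M.map C + (1 : Matrix _ _ ℝ).map C), ?_, fun t => ?_⟩
  · simpa using natDegree_det_X_add_C_le M 1
  · have h1 : (ContinuousLinearMap.id ℝ E + t • A).det = (1 + t • M).det := by
      change LinearMap.det ((ContinuousLinearMap.id ℝ E + t • A : E →L[ℝ] E) : E →ₗ[ℝ] E) = _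
      rw [← LinearMap.det_toMatrix b]
      congr 1
      rw [hM, ContinuousLinearMap.toLinearMap_add, ContinuousLinearMap.toLinearMap_smul, map_add,
        map_smul]
      congr 1
      exact LinearMap.toMatrix_id b
    rw [h1, ← coe_evalRingHom, RingHom.map_det]
    congr 1
    ext i j
    simp [Matrix.map_apply, Matrix.one_apply, apply_ite, add_comm]
    exact mul_comm _ _

open MeasureTheory in
/-- For a map `x ↦ x + g x` of class `C¹` that is the identity outside a ball, the integral
of a power of `1 - ‖y‖² / M²` over the ball transforms as if the map were a diffeomorphism of the
ball, as it is for `x ↦ x + t g x` with small `t`; both sides are polynomials in `t`. -/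
lemma setIntegral_pow_comp_mul_det {E : Type*} [NormedAddCommGroup E] [InnerProductSpace ℝ E]
    [FiniteDimensional ℝ E] [MeasurableSpace E] [BorelSpace E] (μ : Measure E)
    [μ.IsAddHaarMeasure] {g : E → E} (hg : ContDiff ℝ 1 g) {M : ℝ}
    (hgM : ∀ x ∉ Metric.closedBall (0 : E) M, g x = 0) (m : ℕ) :
    ∫ x in Metric.closedBall (0 : E) M,
      (1 - ‖x + g x‖ ^ 2 / M ^ 2) ^ m * (ContinuousLinearMap.id ℝ E + fderiv ℝ g x).det ∂μ =
    ∫ x in Metric.closedBall (0 : E) M, (1 - ‖x‖ ^ 2 / M ^ 2) ^ m ∂μ := by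
  set B := Metric.closedBall (0 : E) M with hB
  have hBc : IsCompact B := isCompact_closedBall _ _
  have hgs : HasCompactSupport g := HasCompactSupport.intro hBc hgM
  obtain ⟨L, hL⟩ := ContDiff.lipschitzWith_of_hasCompactSupport hgs hg one_ne_zero
  have hdg : Continuous (fderiv ℝ g) := hg.continuous_fderiv one_ne_zero
  have hgc : Continuous g := hg.continuous
  choose p hpdeg hpeval using fun x => exists_polynomial_det_id_add_smul (fderiv ℝ g x)
  set w : E → Polynomial ℝ := fun x => Polynomial.C (1 - ‖x‖ ^ 2 / M ^ 2) +
    Polynomial.C (-(2 * inner ℝ x (g x)) / M ^ 2) * Polynomial.X +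
    Polynomial.C (-‖g x‖ ^ 2 / M ^ 2) * Polynomial.X ^ 2 with hw
  have hweval : ∀ x (t : ℝ), (w x).eval t = 1 - ‖x + t • g x‖ ^ 2 / M ^ 2 := by
    intro x t
    simp only [hw, Polynomial.eval_add, Polynomial.eval_mul, Polynomial.eval_C, Polynomial.eval_X,
      Polynomial.eval_pow]
    rw [norm_add_sq_real, inner_smul_right, norm_smul, mul_pow, Real.norm_eq_abs, sq_abs]
    ring
  have hwdeg : ∀ x, (w x).natDegree ≤ 2 := fun x => by
    simp only [hw]
    compute_degree
  have hcont : ∀ t : ℝ, Continuous fun x => (w x ^ m * p x).eval t := by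
    intro t
    simp only [Polynomial.eval_mul, Polynomial.eval_pow, hweval, hpeval]
    refine Continuous.mul (by fun_prop) ?_
    exact ContinuousLinearMap.continuous_det.comp (by fun_prop)
  -- For small `t`, the determinant is positive on the ball.
  have hpos : ∀ᶠ t : ℝ in nhds 0, ∀ x ∈ B,
      0 < (ContinuousLinearMap.id ℝ E + t • fderiv ℝ g x).det := by
    refine hBc.eventually_forall_of_forall_eventually fun x _ => ?_
    have hc : Continuous fun z : ℝ × E =>
        (ContinuousLinearMap.id ℝ E + z.1 • fderiv ℝ g z.2).det :=
      ContinuousLinearMap.continuous_det.comp (by fun_prop)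
    refine hc.continuousAt.eventually (lt_mem_nhds ?_)
    simp [ContinuousLinearMap.det]
  obtain ⟨ε₁, hε₁, hpos⟩ := Metric.eventually_nhds_iff.1 hpos
  set ε := min ε₁ (1 / (L + 1)) with hε
  have hεpos : 0 < ε := lt_min hε₁ (by positivity)
  have hsmall : ∀ t : ℝ, 0 < t → t < ε →
      ∫ x in B, (w x ^ m * p x).eval t ∂μ = ∫ x in B, (1 - ‖x‖ ^ 2 / M ^ 2) ^ m ∂μ := by
    intro t ht htε
    set F : E → E := fun x => x + t • g x with hF
    have hFd : ∀ x, HasFDerivAt F (ContinuousLinearMap.id ℝ E + t • fderiv ℝ g x) x := fun x =>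
      (hasFDerivAt_id x).add (((hg.differentiable one_ne_zero) x).hasFDerivAt.const_smul t)
    have happ : ApproximatesLinearOn F ((ContinuousLinearEquiv.refl ℝ E : E ≃L[ℝ] E) : E →L[ℝ] E)
        univ (t.toNNReal * L) := by
      intro x _ y _
      have : F x - F y - ((ContinuousLinearEquiv.refl ℝ E : E ≃L[ℝ] E) : E →L[ℝ] E) (x - y) =
          t • (g x - g y) := by
        simp only [hF, ContinuousLinearEquiv.coe_coe, ContinuousLinearEquiv.refl_apply, smul_sub]
        abel
      rw [this, norm_smul, Real.norm_of_nonneg ht.le]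
      push_cast
      rw [Real.coe_toNNReal _ ht.le, mul_assoc]
      exact mul_le_mul_of_nonneg_left (hL.norm_sub_le x y) ht.le
    have hlt : Subsingleton E ∨ t.toNNReal * L <
        ‖((ContinuousLinearEquiv.refl ℝ E).symm : E →L[ℝ] E)‖₊⁻¹ := by
      rcases subsingleton_or_nontrivial E with h | h
      · exact Or.inl h
      right
      have h1 : ‖((ContinuousLinearEquiv.refl ℝ E).symm : E →L[ℝ] E)‖₊ = 1 := by
        have : ((ContinuousLinearEquiv.refl ℝ E).symm : E →L[ℝ] E) =
          ContinuousLinearMap.id ℝ E := rfl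
        rw [this]
        exact NNReal.eq (by simp)
      rw [h1, inv_one, ← NNReal.coe_lt_coe]
      push_cast
      rw [Real.coe_toNNReal _ ht.le]
      have h2 : t < 1 / (L + 1) := htε.trans_le (min_le_right _ _)
      rw [lt_div_iff₀ (by positivity)] at h2
      nlinarith [L.coe_nonneg]
    have hinj : Function.Injective F := by
      rw [← injOn_univ]
      exact happ.injOn hlt
    have hsurj : Function.Surjective F := happ.surjective hlt
    have hout : ∀ x ∉ B, F x = x := fun x hx => by simp [hF, hgM x hx]
    have himage : F '' B = B := by
      ext y
      constructor
      · rintro ⟨x, hx, rfl⟩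
        by_contra hy
        exact hy ((hinj (hout _ hy)).symm ▸ hx)
      · intro hy
        obtain ⟨x, rfl⟩ := hsurj y
        refine ⟨x, ?_, rfl⟩
        by_contra hx
        rw [hout x hx] at hy
        exact hx hy
    have hcv := integral_image_eq_integral_abs_det_fderiv_smul μ hBc.measurableSet
      (fun x _ => (hFd x).hasFDerivWithinAt) hinj.injOn (fun y => (1 - ‖y‖ ^ 2 / M ^ 2) ^ m)
    rw [himage] at hcv
    rw [hcv]
    refine setIntegral_congr_fun hBc.measurableSet fun x hx => ?_
    have hd := hpos (y := t) (by
      rw [Real.dist_eq, sub_zero, abs_of_pos ht]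
      exact htε.trans_le (min_le_left _ _)) x hx
    simp only [Polynomial.eval_mul, Polynomial.eval_pow, hweval, hpeval, smul_eq_mul, hF,
      abs_of_pos hd]
    ring
  have hdeg : ∀ x, (w x ^ m * p x).natDegree ≤ m * 2 + Module.finrank ℝ E := fun x =>
    Polynomial.natDegree_mul_le_of_le
      (Polynomial.natDegree_pow_le_of_le m (hwdeg x)) (hpdeg x)
  have := integral_eval_eq_of_forall_small (μ := μ.restrict B) hdeg
    (fun t => (hcont t).continuousOn.integrableOn_compact hBc) hεpos hsmall 1
  simpa only [Polynomial.eval_mul, Polynomial.eval_pow, hweval, hpeval, one_smul] using this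

open MeasureTheory Filter in
/-- For a `C¹` map that is the identity outside a compact set, the Jacobian determinant cannot
vanish at all the points mapped near the origin: the map has degree one.
Otherwise the integrals of `(1 - ‖y‖² / M²) ^ m`, which concentrate at the origin as `m` grows,
would not be preserved. -/
theorem exists_norm_lt_and_det_ne_zero {E : Type*} [NormedAddCommGroup E] [InnerProductSpace ℝ E]
    [FiniteDimensional ℝ E] {g : E → E} (hg : ContDiff ℝ 1 g) (hgs : HasCompactSupport g)
    {δ : ℝ} (hδ : 0 < δ) :
    ∃ x, ‖x + g x‖ < δ ∧ (ContinuousLinearMap.id ℝ E + fderiv ℝ g x).det ≠ 0 := by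
  by_contra! hcon
  borelize E
  set μ : Measure E := (Measure.addHaar : Measure E)
  have hgc : Continuous g := hg.continuous
  obtain ⟨R, hR⟩ := hgs.isCompact.isBounded.subset_closedBall (0 : E)
  obtain ⟨S, hS⟩ := hgs.exists_bound_of_continuous hgc
  set M : ℝ := max (max (max R 0 + S) δ) R with hMdef
  have hMR : R ≤ M := le_max_right _ _
  have hMδ : δ ≤ M := (le_max_right _ _).trans (le_max_left _ _)
  have hM : 0 < M := hδ.trans_le hMδ
  set B := Metric.closedBall (0 : E) M with hB
  have hBc : IsCompact B := isCompact_closedBall _ _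
  have hout : ∀ x ∉ Metric.closedBall (0 : E) R, g x = 0 := fun x hx =>
    image_eq_zero_of_notMem_tsupport fun h => hx (hR h)
  have hgM : ∀ x ∉ B, g x = 0 := fun x hx =>
    hout x fun h => hx (Metric.closedBall_subset_closedBall hMR h)
  have hFM : ∀ x ∈ B, ‖x + g x‖ ≤ M := by
    intro x hx
    by_cases hxR : x ∈ Metric.closedBall (0 : E) R
    · calc ‖x + g x‖ ≤ ‖x‖ + ‖g x‖ := norm_add_le _ _
        _ ≤ max R 0 + S :=
            add_le_add ((mem_closedBall_zero_iff.1 hxR).trans (le_max_left _ _)) (hS x)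
        _ ≤ M := (le_max_left _ _).trans (le_max_left _ _)
    · rw [hout x hxR, add_zero]
      exact mem_closedBall_zero_iff.1 hx
  set J : E → ℝ := fun x => (ContinuousLinearMap.id ℝ E + fderiv ℝ g x).det with hJ
  have hJc : Continuous J := ContinuousLinearMap.continuous_det.comp
    (continuous_const.add (hg.continuous_fderiv one_ne_zero))
  obtain ⟨C, hC⟩ := hBc.exists_bound_of_continuousOn hJc.continuousOn
  set a : ℝ := 1 - δ ^ 2 / M ^ 2 with ha
  set b : ℝ := 1 - (δ / 2) ^ 2 / M ^ 2 with hb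
  have ha0 : 0 ≤ a := by
    rw [ha, sub_nonneg, div_le_one (by positivity)]
    exact pow_le_pow_left₀ hδ.le hMδ 2
  have hab : a < b := by
    rw [ha, hb]
    have : (δ / 2) ^ 2 / M ^ 2 < δ ^ 2 / M ^ 2 := by
      apply div_lt_div_of_pos_right _ (by positivity)
      nlinarith
    linarith
  have hb0 : 0 < b := ha0.trans_lt hab
  have hC0 : 0 ≤ C := (norm_nonneg _).trans (hC 0 (Metric.mem_closedBall_self hM.le))
  have hupper : ∀ m : ℕ, ∫ x in B, (1 - ‖x + g x‖ ^ 2 / M ^ 2) ^ m * J x ∂μ ≤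
      a ^ m * C * μ.real B := by
    intro m
    refine (Real.le_norm_self _).trans (norm_setIntegral_le_of_norm_le_const hBc.measure_lt_top ?_)
    intro x hx
    rw [norm_mul]
    by_cases hxδ : ‖x + g x‖ < δ
    · rw [show J x = 0 from hcon x hxδ, norm_zero, mul_zero]
      positivity
    · refine mul_le_mul ?_ (hC x hx) (norm_nonneg _) (by positivity)
      have h1 : 0 ≤ 1 - ‖x + g x‖ ^ 2 / M ^ 2 := by
        rw [sub_nonneg, div_le_one (by positivity)]
        exact pow_le_pow_left₀ (norm_nonneg _) (hFM x hx) 2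
      rw [norm_pow, Real.norm_of_nonneg h1]
      refine pow_le_pow_left₀ h1 ?_ m
      rw [ha]
      have : δ ^ 2 / M ^ 2 ≤ ‖x + g x‖ ^ 2 / M ^ 2 :=
        div_le_div_of_nonneg_right (pow_le_pow_left₀ hδ.le (not_lt.1 hxδ) 2) (by positivity)
      linarith
  set D := Metric.closedBall (0 : E) (δ / 2) with hD
  have hDB : D ⊆ B := Metric.closedBall_subset_closedBall (by linarith)
  have hlower : ∀ m : ℕ, b ^ m * μ.real D ≤ ∫ x in B, (1 - ‖x‖ ^ 2 / M ^ 2) ^ m ∂μ := by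
    intro m
    have hcont : Continuous fun x : E => (1 - ‖x‖ ^ 2 / M ^ 2) ^ m := by fun_prop
    calc b ^ m * μ.real D = ∫ _ in D, b ^ m ∂μ := by
          rw [setIntegral_const, smul_eq_mul, mul_comm]
      _ ≤ ∫ x in D, (1 - ‖x‖ ^ 2 / M ^ 2) ^ m ∂μ := by
          refine setIntegral_mono_on (integrableOn_const (hs :=
            (isCompact_closedBall (0 : E) (δ / 2)).measure_lt_top.ne))
            (hcont.continuousOn.integrableOn_compact (isCompact_closedBall _ _))
            measurableSet_closedBall fun x hx => ?_
          refine pow_le_pow_left₀ hb0.le ?_ m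
          have : ‖x‖ ^ 2 / M ^ 2 ≤ (δ / 2) ^ 2 / M ^ 2 :=
            div_le_div_of_nonneg_right
              (pow_le_pow_left₀ (norm_nonneg _) (mem_closedBall_zero_iff.1 hx) 2) (by positivity)
          rw [hb]
          linarith
      _ ≤ _ := by
          refine setIntegral_mono_set (hcont.continuousOn.integrableOn_compact hBc) ?_
            hDB.eventuallyLE
          refine (ae_restrict_iff' hBc.measurableSet).2 (Eventually.of_forall fun x hx => ?_)
          refine pow_nonneg ?_ m
          rw [sub_nonneg, div_le_one (by positivity)]
          exact pow_le_pow_left₀ (norm_nonneg _) (mem_closedBall_zero_iff.1 hx) 2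
  have hDpos : 0 < μ.real D := ENNReal.toReal_pos
    (Metric.measure_closedBall_pos μ 0 (by positivity)).ne'
    (isCompact_closedBall (0 : E) (δ / 2)).measure_lt_top.ne
  have hineq : ∀ m : ℕ, μ.real D ≤ (a / b) ^ m * (C * μ.real B) := by
    intro m
    have h := (hlower m).trans
      ((setIntegral_pow_comp_mul_det μ hg hgM m).symm.le.trans (hupper m))
    rw [div_pow, div_mul_eq_mul_div, le_div_iff₀ (by positivity)]
    linarith
  have hlim : Tendsto (fun m : ℕ => (a / b) ^ m * (C * μ.real B)) atTop
      (nhds (0 * (C * μ.real B))) :=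
    (tendsto_pow_atTop_nhds_zero_of_lt_one (by positivity) ((div_lt_one hb0).2 hab)).mul_const _
  rw [zero_mul] at hlim
  exact absurd (ge_of_tendsto' hlim hineq) (not_le.2 hDpos)

/-! ### Covers of a convex body by sets that fit in a smaller copy -/

/-- If at most `finrank` of the vectors `t i` carry weights `φ i` near `x`, and the weights sum to
one there, then `∑ φ i • t i` has rank less than `finrank` at `x`, as it maps a neighborhood of `x`
into an affine subspace of smaller dimension. -/
lemma det_fderiv_sum_smul_eq_zero {E ι : Type*} [NormedAddCommGroup E] [NormedSpace ℝ E]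
    [FiniteDimensional ℝ E] [Fintype ι] {φ : ι → E → ℝ} {x : E}
    (hφ : ∀ i, DifferentiableAt ℝ (φ i) x) (hsum : ∀ᶠ y in nhds x, ∑ i, φ i y = 1)
    (hcard : {i | x ∈ tsupport (φ i)}.encard ≤ Module.finrank ℝ E) (t : ι → E) :
    (fderiv ℝ (fun y => ∑ i, φ i y • t i) x).det = 0 := by
  classical
  set I : Finset ι := Finset.univ.filter fun i => x ∈ tsupport (φ i) with hI
  have hIcard : I.card ≤ Module.finrank ℝ E := by
    have : {i | x ∈ tsupport (φ i)} = (I : Set ι) := by ext; simp [hI]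
    rw [this, Set.encard_coe_eq_coe_finsetCard] at hcard
    exact_mod_cast hcard
  have hzero : ∀ i ∉ I, φ i =ᶠ[nhds x] 0 := fun i hi => by
    rw [← notMem_tsupport_iff_eventuallyEq]
    simpa [hI] using hi
  obtain ⟨i₀, hi₀⟩ : I.Nonempty := by
    rw [Finset.nonempty_iff_ne_empty]
    intro h
    have h1 : ∑ i, φ i x = 0 :=
      Finset.sum_eq_zero fun i _ => (hzero i (by simp [h])).self_of_nhds
    rw [hsum.self_of_nhds] at h1
    exact one_ne_zero h1
  have hd : ∀ v, fderiv ℝ (fun y => ∑ i, φ i y • t i) x v = ∑ i, fderiv ℝ (φ i) x v • t i := by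
    intro v
    have h : HasFDerivAt (fun y => ∑ i, φ i y • t i)
        (∑ i, (fderiv ℝ (φ i) x).smulRight (t i)) x :=
      HasFDerivAt.fun_sum fun i _ => (hφ i).hasFDerivAt.smul_const (t i)
    rw [h.fderiv]
    simp
  have hd0 : ∀ v, ∑ i, fderiv ℝ (φ i) x v = 0 := by
    intro v
    have h : HasFDerivAt (fun y => ∑ i, φ i y) (∑ i, fderiv ℝ (φ i) x) x :=
      HasFDerivAt.fun_sum fun i _ => (hφ i).hasFDerivAt
    have h' : HasFDerivAt (fun y => ∑ i, φ i y) (0 : E →L[ℝ] ℝ) x :=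
      (hasFDerivAt_const (1 : ℝ) x).congr_of_eventuallyEq hsum
    have := congrArg (fun f : E →L[ℝ] ℝ => f v) (h.unique h')
    simpa using this
  set S : Finset E := (I.erase i₀).image fun i => t i - t i₀ with hS
  have hrange : ∀ v, fderiv ℝ (fun y => ∑ i, φ i y • t i) x v ∈ Submodule.span ℝ (S : Set E) := by
    intro v
    have : ∑ i, fderiv ℝ (φ i) x v • t i = ∑ i, fderiv ℝ (φ i) x v • (t i - t i₀) := by
      simp_rw [smul_sub, Finset.sum_sub_distrib]
      rw [← Finset.sum_smul, hd0, zero_smul, sub_zero]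
    rw [hd, this]
    refine Submodule.sum_mem _ fun i _ => ?_
    by_cases hi : i ∈ I
    · by_cases h : i = i₀
      · simp [h]
      · exact Submodule.smul_mem _ _ (Submodule.subset_span
          (Finset.mem_coe.2 (Finset.mem_image_of_mem _ (Finset.mem_erase.2 ⟨h, hi⟩))))
    · rw [(hzero i hi).fderiv_eq]
      simp
  by_contra hdet
  have hsurj : Function.Surjective (fderiv ℝ (fun y => ∑ i, φ i y • t i) x) :=
    (LinearMap.equivOfDetNeZero _ hdet).surjective
  have htop : Submodule.span ℝ (S : Set E) = ⊤ := by
    rw [eq_top_iff]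
    intro y _
    obtain ⟨v, rfl⟩ := hsurj y
    exact hrange v
  have h1 := finrank_span_finset_le_card (R := ℝ) S
  rw [Set.finrank, htop, finrank_top] at h1
  have h2 : S.card ≤ (I.erase i₀).card := Finset.card_image_le
  rw [Finset.card_erase_of_mem hi₀] at h2
  have h3 : 0 < I.card := Finset.card_pos.2 ⟨i₀, hi₀⟩
  omega

open scoped Manifold ContDiff in
/-- Lebesgue's covering theorem for a convex body `K` with the origin in its interior: in a finite
open cover of `K` by sets that fit in a smaller copy of `K`, some point lies in more than
`finrank` members. -/
theorem exists_finrank_lt_encard_of_zero_mem {E ι : Type*} [NormedAddCommGroup E]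
    [InnerProductSpace ℝ E] [FiniteDimensional ℝ E] [Finite ι] {K : Set E} (hK : Convex ℝ K)
    (hKc : IsCompact K) (h0 : (0 : E) ∈ interior K) {U : ι → Set E} (hU : ∀ i, IsOpen (U i))
    (hKU : K ⊆ ⋃ i, U i) {lam : ℝ} (hlam0 : 0 ≤ lam) (hlam1 : lam < 1)
    (hfit : ∀ i, FitsIn K lam (U i ∩ K)) :
    ∃ x ∈ K, (Module.finrank ℝ E : ℕ∞) < {i | x ∈ U i}.encard := by
  by_contra! hcon
  have := Fintype.ofFinite ι
  choose t ht using hfit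
  have hK0 : (0 : E) ∈ K := interior_subset h0
  have hKsmul : ∀ k ∈ K, ∀ a : ℝ, 0 ≤ a → a ≤ 1 → a • k ∈ K := fun k hk a ha ha' =>
    hK.smul_mem_of_zero_mem hK0 hk ⟨ha, ha'⟩
  obtain ⟨φ, hφ⟩ := SmoothPartitionOfUnity.exists_isSubordinate 𝓘(ℝ, E) hKc.isClosed U hU hKU
  have hφd : ∀ i, ContDiff ℝ ∞ (φ i) := fun i => (φ i).contMDiff.contDiff
  have hφsum : ∀ x ∈ K, ∑ i, φ i x = 1 := fun x hx => by
    rw [← finsum_eq_sum_of_fintype]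
    exact φ.sum_eq_one hx
  set ρ : E → E := fun x => ∑ i, φ i x • t i with hρ
  have hρd : ContDiff ℝ ∞ ρ := ContDiff.sum fun i _ => (hφd i).smul contDiff_const
  -- On `K`, the displacement of `x ↦ ρ x` lies in `lam • K`.
  have hρK : ∀ x ∈ K, ∃ k ∈ K, x - ρ x = lam • k := by
    intro x hx
    have : ∀ i, ∃ k ∈ K, φ i x ≠ 0 → x = t i + lam • k := by
      intro i
      by_cases h : φ i x = 0
      · exact ⟨0, hK0, fun h' => absurd h h'⟩
      · obtain ⟨k, hk, hk'⟩ := ht i x ⟨hφ i (subset_tsupport _ h), hx⟩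
        exact ⟨k, hk, fun _ => hk'⟩
    choose k hk hk' using this
    refine ⟨∑ i, φ i x • k i,
      hK.sum_mem (fun i _ => φ.nonneg i x) (hφsum x hx) fun i _ => hk i, ?_⟩
    calc x - ρ x = ∑ i, φ i x • (x - t i) := by
          simp_rw [smul_sub, Finset.sum_sub_distrib]
          rw [← Finset.sum_smul, hφsum x hx, one_smul]
      _ = lam • ∑ i, φ i x • k i := by
          rw [Finset.smul_sum]
          refine Finset.sum_congr rfl fun i _ => ?_
          by_cases h : φ i x = 0
          · simp [h]
          · rw [smul_comm]
            congr 1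
            exact sub_eq_iff_eq_add'.2 (hk' i h)
  obtain ⟨l, hl, hl1⟩ := exists_between hlam1
  have hl0 : 0 ≤ l := hlam0.trans hl.le
  have hlK : l • K ⊆ interior K := by
    rintro _ ⟨k, hk, rfl⟩
    have := hK.combo_interior_self_mem_interior h0 hk (sub_pos.2 hl1) hl0 (by ring)
    simpa using this
  obtain ⟨χ, hχ1, hχ0, hχ⟩ := exists_contMDiffMap_one_nhds_of_subset_interior (n := (⊤ : ℕ∞))
    𝓘(ℝ, E) (hKc.smul l).isClosed hlK
  have hχd : ContDiff ℝ ∞ χ := χ.contMDiff.contDiff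
  have hχ1' : ∀ x ∈ l • K, ∀ᶠ y in nhds x, χ y = 1 := fun x hx =>
    hχ1.filter_mono (nhds_le_nhdsSet hx)
  obtain ⟨δ, hδ, hδK⟩ : ∃ δ > 0, Metric.ball (0 : E) δ ⊆ (l - lam) • K := by
    rw [← Metric.mem_nhds_iff]
    exact (set_smul_mem_nhds_zero_iff (sub_pos.2 hl).ne').2 (mem_interior_iff_mem_nhds.1 h0)
  -- `x + g x` equals `ρ x` on `l • K` and `x` outside `K`.
  set g : E → E := fun x => -(χ x • (x - ρ x)) with hg
  have hgd : ContDiff ℝ ∞ g := (hχd.smul (contDiff_id.sub hρd)).neg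
  have hgs : HasCompactSupport g := HasCompactSupport.intro hKc fun x hx => by
    simp [hg, hχ0 x hx]
  obtain ⟨x, hxδ, hdet⟩ := exists_norm_lt_and_det_ne_zero (hgd.of_le (by simp)) hgs hδ
  obtain ⟨k', hk', hk'x : (l - lam) • k' = x + g x⟩ := hδK (mem_ball_zero_iff.2 hxδ)
  have hxl : x ∈ l • K := by
    by_cases hx : x ∈ K
    · obtain ⟨k, hk, hkx⟩ := hρK x hx
      obtain ⟨z, hz, hz'⟩ := hK.exists_mem_add_smul_eq
        (hKsmul k hk (χ x) (hχ x).1 (hχ x).2) hk' hlam0 (sub_pos.2 hl).le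
      refine ⟨z, hz, ?_⟩
      change l • z = x
      rw [show l = lam + (l - lam) by ring, hz', hk'x, hg, smul_comm, ← hkx]
      exact (add_comm _ _).trans (neg_add_cancel_right _ _)
    · exfalso
      refine hx ?_
      have : x = (l - lam) • k' := by rw [hk'x, hg]; simp [hχ0 x hx]
      rw [this]
      exact hKsmul k' hk' _ (sub_pos.2 hl).le (by linarith)
  have hxK : x ∈ interior K := hlK hxl
  have hρx : HasFDerivAt ρ (fderiv ℝ ρ x) x :=
    ((hρd.differentiable (by simp)) x).hasFDerivAt
  have hgx : HasFDerivAt g (-(ContinuousLinearMap.id ℝ E - fderiv ℝ ρ x)) x :=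
    ((hasFDerivAt_id x).sub hρx).neg.congr_of_eventuallyEq
      ((hχ1' x hxl).mono fun y hy => by simp [hg, hy])
  refine hdet ?_
  rw [hgx.fderiv, neg_sub, add_sub_cancel]
  refine det_fderiv_sum_smul_eq_zero (fun i => ((hφd i).differentiable (by simp)) x)
    (Filter.eventually_of_mem (mem_interior_iff_mem_nhds.1 hxK) hφsum)
    ((encard_le_encard fun i hi => hφ i hi).trans (hcon x (interior_subset hxK))) t

/-- Lebesgue's covering theorem for a convex body `K`: in a finite open cover of `K` by sets that
fit in a smaller copy of `K`, some point lies in more than `finrank` members. -/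
theorem exists_finrank_lt_encard_of_cover {E ι : Type*} [NormedAddCommGroup E]
    [InnerProductSpace ℝ E] [FiniteDimensional ℝ E] [Finite ι] {K : Set E} (hK : Convex ℝ K)
    (hKc : IsCompact K) (hKi : (interior K).Nonempty) {U : ι → Set E} (hU : ∀ i, IsOpen (U i))
    (hKU : K ⊆ ⋃ i, U i) {lam : ℝ} (hlam0 : 0 ≤ lam) (hlam1 : lam < 1)
    (hfit : ∀ i, FitsIn K lam (U i ∩ K)) :
    ∃ x ∈ K, (Module.finrank ℝ E : ℕ∞) < {i | x ∈ U i}.encard := by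
  obtain ⟨c, hc⟩ := hKi
  set h := Homeomorph.addRight c
  have hcont : Continuous fun x : E => x + c := by fun_prop
  have hfit' : ∀ i, FitsIn ((fun x => x + c) ⁻¹' K) lam
      ((fun x => x + c) ⁻¹' U i ∩ (fun x => x + c) ⁻¹' K) := by
    intro i
    obtain ⟨t, ht⟩ := hfit i
    refine ⟨t + lam • c - c, fun x hx => ?_⟩
    obtain ⟨k, hk, hkx⟩ := ht (x + c) hx
    refine ⟨k - c, by simpa using hk, ?_⟩
    rw [smul_sub, eq_sub_of_add_eq hkx]
    abel
  obtain ⟨x, hx, hlt⟩ := exists_finrank_lt_encard_of_zero_mem (K := (fun x => x + c) ⁻¹' K)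
    (U := fun i => (fun x => x + c) ⁻¹' U i) (hK.translate_preimage_left c)
    (h.isClosedEmbedding.isCompact_preimage hKc)
    (preimage_interior_subset_interior_preimage hcont (by simpa using hc))
    (fun i => (hU i).preimage hcont) (fun x hx => by simpa using hKU hx) hlam0 hlam1 hfit'
  exact ⟨x + c, hx, hlt⟩

/-! ### Sets of small length -/

lemma sub_self_mem_nhds_zero {V : Type*} [NormedAddCommGroup V] {K : Set V}
    (hKi : (interior K).Nonempty) : K - K ∈ nhds (0 : V) := by
  obtain ⟨c, hc⟩ := hKi
  have h : (fun x => x + c) ⁻¹' interior K ∈ nhds (0 : V) :=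
    (isOpen_interior.preimage (by fun_prop)).mem_nhds (by simpa using hc)
  filter_upwards [h] with x hx
  exact ⟨x + c, interior_subset hx, c, interior_subset hc, by simp⟩

section Gauge

variable {V : Type*} [NormedAddCommGroup V] [NormedSpace ℝ V] {K : Set V}

lemma exists_eq_smul_sub_of_gauge_lt (hK : Convex ℝ K) (hKi : (interior K).Nonempty) {x : V}
    {d : ℝ} (hx : gauge (K - K) x < d) : ∃ u ∈ K, ∃ v ∈ K, x = d • (u - v) := by
  have hB := sub_self_mem_nhds_zero hKi
  obtain ⟨b, hb, hbd, y, hy, rfl⟩ := exists_lt_of_gauge_lt (absorbent_nhds_zero hB) hx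
  have hd : 0 < d := hb.trans hbd
  obtain ⟨u, hu, v, hv, huv⟩ := (hK.sub hK).smul_mem_of_zero_mem (mem_of_mem_nhds hB) hy
    (t := b / d) ⟨by positivity, (div_le_one hd).2 hbd.le⟩
  refine ⟨u, hu, v, hv, ?_⟩
  change b • y = _
  rw [show u - v = (b / d) • y from huv, smul_smul, mul_div_cancel₀ _ hd.ne']

lemma gauge_le_gaugeDiam_toReal {B s : Set V} (hs : gaugeDiam B s ≠ ∞) {x y : V} (hx : x ∈ s)
    (hy : y ∈ s) : gauge B (x - y) ≤ (gaugeDiam B s).toReal := by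
  rw [← ENNReal.ofReal_le_iff_le_toReal hs]
  exact (le_iSup₂ (f := fun y (_ : y ∈ s) => ENNReal.ofReal (gauge B (x - y))) y hy).trans
    (le_iSup₂ (f := fun x (_ : x ∈ s) => ⨆ y ∈ s, ENNReal.ofReal (gauge B (x - y))) x hx)

/-- A compact set of length less than one in the norm with unit ball `K - K` is covered by finitely
many pairwise disjoint open sets, each of which fits in a smaller copy of `K`. -/
theorem exists_disjoint_cover_of_gaugeLength_lt_one [FiniteDimensional ℝ V] (hK : Convex ℝ K)
    (hKc : IsCompact K) (hKi : (interior K).Nonempty) {s : Set V} (hs : IsCompact s)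
    (hlen : gaugeLength (K - K) s < 1) :
    ∃ lam : ℝ, 0 ≤ lam ∧ lam < 1 ∧ ∃ (κ : Type) (_ : Finite κ) (P : κ → Set V),
      (∀ j, IsOpen (P j)) ∧ (∀ j j' x, x ∈ P j → x ∈ P j' → j = j') ∧
      (∀ j, FitsIn K lam (P j)) ∧ s ⊆ ⋃ j, P j := by
  set B := K - K with hBdef
  have hB : B ∈ nhds (0 : V) := sub_self_mem_nhds_zero hKi
  have hBconv : Convex ℝ B := hK.sub hK
  have hBabs : Absorbent ℝ B := absorbent_nhds_zero hB
  have hBsymm : ∀ x ∈ B, -x ∈ B := by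
    rintro _ ⟨u, hu, v, hv, rfl⟩
    exact ⟨v, hv, u, hu, by simp⟩
  have hBcont : Continuous (gauge B) := continuous_gauge hBconv hB
  obtain ⟨L, hL0, hL, hL1⟩ := ENNReal.lt_iff_exists_real_btwn.1 hlen
  rw [ENNReal.ofReal_lt_one] at hL1
  set N : ℕ := Module.finrank ℝ V + 1 with hN
  -- Diameters at most `2 η` make the error term `N * 2 η` harmless.
  set η : ℝ := (1 - L) / (2 * (N + 1)) with hη
  have hη0 : 0 < η := div_pos (by linarith) (by positivity)
  have hηN : η * (2 * (N + 1)) = 1 - L := div_mul_cancel₀ _ (by positivity)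
  have hinf := (le_iSup₂ (f := fun (r : ℝ≥0∞) (_ : 0 < r) =>
    ⨅ (t : ℕ → Set V) (_ : s ⊆ ⋃ i, t i) (_ : ∀ i, gaugeDiam B (t i) ≤ r), ∑' i, gaugeDiam B (t i))
    (ENNReal.ofReal η) (ENNReal.ofReal_pos.2 hη0)).trans_lt hL
  simp only [iInf_lt_iff] at hinf
  obtain ⟨t, hst, htη, htL⟩ := hinf
  obtain ⟨e, he0, heη⟩ := ENNReal.exists_pos_sum_of_countable (ENNReal.ofReal_pos.2 hη0).ne' ℕ
  have hfin : ∀ i, gaugeDiam B (t i) ≠ ∞ := fun i =>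
    ((htη i).trans_lt ENNReal.ofReal_lt_top).ne
  set d : ℕ → ℝ := fun i => (gaugeDiam B (t i)).toReal + e i with hd
  have hd0 : ∀ i, 0 ≤ d i := fun i => by positivity
  have hdη : ∀ i, d i ≤ 2 * η := by
    intro i
    have h1 : (gaugeDiam B (t i)).toReal ≤ η := ENNReal.toReal_le_of_le_ofReal hη0.le (htη i)
    have h2 : (e i : ℝ) ≤ η := by
      have := ENNReal.toReal_le_of_le_ofReal hη0.le ((ENNReal.le_tsum i).trans heη.le)
      simpa using this
    simp only [hd]
    linarith
  set U : ℕ → Set V := fun i => ⋃ y ∈ t i, {x | gauge B (x - y) < e i / 2} with hU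
  have hUo : ∀ i, IsOpen (U i) := fun i => isOpen_biUnion fun y _ =>
    isOpen_lt (hBcont.comp (by fun_prop)) continuous_const
  have hsU : s ⊆ ⋃ i, U i := by
    intro x hx
    obtain ⟨i, hi⟩ := mem_iUnion.1 (hst hx)
    have : (0 : ℝ) < e i := he0 i
    exact mem_iUnion.2 ⟨i, mem_biUnion hi (by simpa using this)⟩
  have hUd : ∀ i, ∀ x ∈ U i, ∀ y ∈ U i, ∃ u ∈ K, ∃ v ∈ K, x - y = d i • (u - v) := by
    intro i x hx y hy
    simp only [hU, mem_iUnion, mem_ofPred_eq] at hx hy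
    obtain ⟨x', hx', hxx⟩ := hx
    obtain ⟨y', hy', hyy⟩ := hy
    refine exists_eq_smul_sub_of_gauge_lt hK hKi ?_
    have h1 : gauge B (y' - y) < e i / 2 := by rwa [← gauge_neg hBsymm, neg_sub]
    have h2 := gauge_le_gaugeDiam_toReal (hfin i) hx' hy'
    have h3 := gauge_add_le hBconv hBabs (x - x') (x' - y')
    have h4 := gauge_add_le hBconv hBabs (x - x' + (x' - y')) (y' - y)
    rw [show x - x' + (x' - y') + (y' - y) = x - y by abel] at h4
    simp only [hd]
    linarith
  obtain ⟨I, hI⟩ := hs.elim_finite_subcover U hUo hsU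
  have hsum : ∑ i : I, d i ≤ L + η := by
    rw [Finset.sum_coe_sort I d]
    simp only [hd, Finset.sum_add_distrib]
    refine add_le_add ?_ ?_
    · rw [← ENNReal.toReal_sum fun i _ => hfin i]
      exact ENNReal.toReal_le_of_le_ofReal hL0 ((ENNReal.sum_le_tsum I).trans htL.le)
    · have := ENNReal.toReal_le_of_le_ofReal hη0.le ((ENNReal.sum_le_tsum I).trans heη.le)
      rw [ENNReal.toReal_sum fun i _ => ENNReal.coe_ne_top] at this
      simpa using this
  have hKne : K.Nonempty := hKi.mono interior_subset
  have hsum0 : 0 ≤ ∑ i : I, d i := Finset.sum_nonneg fun i _ => hd0 i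
  set G : SimpleGraph I := SimpleGraph.fromRel fun i j => (U i ∩ U j).Nonempty with hG
  have hGadj : ∀ i j, G.Adj i j → (U i ∩ U j).Nonempty := by
    intro i j hij
    rw [hG, SimpleGraph.fromRel_adj] at hij
    rcases hij.2 with h | h
    · exact h
    · rwa [inter_comm]
  refine ⟨∑ i : I, d i + N * (2 * η), by positivity, by nlinarith, G.ConnectedComponent,
    inferInstance, fun c => ⋃ i ∈ {i | G.connectedComponentMk i = c}, U i,
    fun c => isOpen_biUnion fun i _ => hUo i, ?_,
    fun c => fitsIn_cluster hK hKc (U := fun i : I => U i) (d := fun i : I => d i)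
      (fun i => hd0 i) (fun i => hdη i) (fun i => hUd i) hGadj c, ?_⟩
  · intro c c' x hx hx'
    simp only [mem_iUnion, mem_ofPred_eq] at hx hx'
    obtain ⟨i, rfl, hi⟩ := hx
    obtain ⟨j, rfl, hj⟩ := hx'
    by_cases hij : i = j
    · rw [hij]
    · refine SimpleGraph.ConnectedComponent.eq.2 (SimpleGraph.Adj.reachable ?_)
      rw [hG, SimpleGraph.fromRel_adj]
      exact ⟨hij, Or.inl ⟨x, hi, hj⟩⟩
  · intro x hx
    obtain ⟨i, hiI, hi⟩ := mem_iUnion₂.1 (hI hx)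
    exact mem_iUnion.2 ⟨G.connectedComponentMk ⟨i, hiI⟩, mem_biUnion (x := (⟨i, hiI⟩ : I)) rfl hi⟩

end Gauge

/-! ### Fibers of continuous maps -/

theorem theorem5p5 (n : ℕ) (K : Set (EuclideanSpace ℝ (Fin n)))
    (hK_convex : Convex ℝ K) (hK_compact : IsCompact K) (hK_interior : (interior K).Nonempty)
    (Y : Type*) [TopologicalSpace Y] [T2Space Y] (hY : CoveringDimLT Y n)
    (f : K → Y) (hf : Continuous f) :
    ∃ y : Y, 1 ≤ gaugeLength (K - K) (Subtype.val '' (f ⁻¹' {y})) := by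
  by_contra! hcon
  have := isCompact_iff_compactSpace.1 hK_compact
  have hfib : ∀ y : Y, IsCompact (Subtype.val '' (f ⁻¹' {y})) := fun y =>
    (isClosed_singleton.preimage hf).isCompact.image continuous_subtype_val
  choose lam hlam0 hlam1 κ hκ P hPo hPd hPfit hPcov using fun y =>
    exists_disjoint_cover_of_gaugeLength_lt_one hK_convex hK_compact hK_interior (hfib y) (hcon y)
  -- `V y` is the set of points whose whole fiber lies in the cover of the fiber over `y`.
  set V : Y → Set Y := fun y => (f '' (Subtype.val ⁻¹' (⋃ j, P y j)ᶜ))ᶜ with hV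
  have hVo : ∀ y, IsOpen (V y) := fun y =>
    (((isOpen_iUnion (hPo y)).isClosed_compl.preimage
      continuous_subtype_val).isCompact.image hf).isClosed.isOpen_compl
  have hyV : ∀ y, y ∈ V y := by
    rintro y ⟨x, hx, hxy⟩
    exact hx (hPcov y ⟨x, hxy, rfl⟩)
  have hVP : ∀ y (x : K), f x ∈ V y → (x : EuclideanSpace ℝ (Fin n)) ∈ ⋃ j, P y j := by
    intro y x hx
    by_contra h
    exact hx ⟨x, h, rfl⟩
  obtain ⟨S, hS⟩ := (isCompact_range hf).elim_finite_subcover V hVo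
    fun y _ => mem_iUnion.2 ⟨y, hyV y⟩
  obtain ⟨W, hWfin, hWo, hWcov, hWref, hWn⟩ := hY (insert (range f)ᶜ (V '' S))
    ((S.finite_toSet.image V).insert _)
    (by
      rintro u (rfl | ⟨y, -, rfl⟩)
      · exact (isCompact_range hf).isClosed.isOpen_compl
      · exact hVo y)
    (by
      refine eq_univ_of_forall fun y => ?_
      by_cases hy : y ∈ range f
      · obtain ⟨z, hz, hyz⟩ := mem_iUnion₂.1 (hS hy)
        exact ⟨V z, Or.inr ⟨z, hz, rfl⟩, hyz⟩
      · exact ⟨_, Or.inl rfl, hy⟩)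
  have hgood : ∀ w : W, ∃ lam : ℝ, 0 ≤ lam ∧ lam < 1 ∧ ∃ (κ : Type) (_ : Finite κ)
      (P : κ → Set (EuclideanSpace ℝ (Fin n))),
      (∀ j, IsOpen (P j)) ∧ (∀ j j' x, x ∈ P j → x ∈ P j' → j = j') ∧
      (∀ j, FitsIn K lam (P j)) ∧
      ∀ x : K, f x ∈ w.1 → (x : EuclideanSpace ℝ (Fin n)) ∈ ⋃ j, P j := by
    rintro ⟨w, hw⟩
    obtain ⟨u, hu | ⟨y, -, rfl⟩, hwu⟩ := hWref w hw
    · refine ⟨0, le_rfl, one_pos, PEmpty, inferInstance, PEmpty.elim, fun j => j.elim,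
        fun j => j.elim, fun j => j.elim, fun x hx => ?_⟩
      have := hwu hx
      rw [hu] at this
      exact absurd (mem_range_self x) this
    · exact ⟨lam y, hlam0 y, hlam1 y, κ y, hκ y, P y, hPo y, hPd y, hPfit y,
        fun x hx => hVP y x (hwu hx)⟩
  choose μ hμ0 hμ1 ι hι Q hQo hQd hQfit hQcov using hgood
  have := hWfin.to_subtype
  obtain ⟨ν, ⟨hμν, hν0⟩, hν1⟩ : ∃ ν : ℝ, ((∀ w, μ w ≤ ν) ∧ 0 ≤ ν) ∧ ν < 1 := by
    have h1 : ∀ᶠ ν : ℝ in nhdsWithin 1 (Iio 1), ∀ w, μ w ≤ ν :=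
      Filter.eventually_all.2 fun w => nhdsWithin_le_nhds (eventually_ge_nhds (hμ1 w))
    have h2 : ∀ᶠ ν : ℝ in nhdsWithin 1 (Iio 1), 0 ≤ ν :=
      nhdsWithin_le_nhds (eventually_ge_nhds one_pos)
    exact ((h1.and h2).and self_mem_nhdsWithin).exists
  have hA : ∀ w : W, ∃ A : Set (EuclideanSpace ℝ (Fin n)), IsOpen A ∧
      Subtype.val ⁻¹' A = f ⁻¹' w.1 := fun w =>
    isOpen_induced_iff.1 ((hWo w.1 w.2).preimage hf)
  choose A hAo hAf using hA
  have hAiff : ∀ (w : W) (x : K), (x : EuclideanSpace ℝ (Fin n)) ∈ A w ↔ f x ∈ w.1 := fun w x =>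
    Set.ext_iff.1 (hAf w) x
  have hKne : K.Nonempty := hK_interior.mono interior_subset
  obtain ⟨x, hx, hlt⟩ := exists_finrank_lt_encard_of_cover (ι := Σ w : W, ι w) hK_convex hK_compact
    hK_interior (U := fun i => A i.1 ∩ Q i.1 i.2) (fun i => (hAo i.1).inter (hQo i.1 i.2))
    (by
      intro x hx
      obtain ⟨w, hw, hxw⟩ := mem_sUnion.1 (hWcov.symm ▸ mem_univ (f ⟨x, hx⟩))
      obtain ⟨j, hj⟩ := mem_iUnion.1 (hQcov ⟨w, hw⟩ ⟨x, hx⟩ hxw)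
      exact mem_iUnion.2 ⟨⟨⟨w, hw⟩, j⟩, (hAiff ⟨w, hw⟩ ⟨x, hx⟩).2 hxw, hj⟩)
    hν0 hν1
    (fun i => ((hQfit i.1 i.2).mono hK_convex hKne (hμ0 i.1) (hμν i.1)).subset
      (inter_subset_left.trans inter_subset_right))
  refine absurd hlt (not_lt.2 ?_)
  rw [finrank_euclideanSpace_fin]
  -- The pieces over a given `w` are disjoint, so passing to them does not raise the multiplicity.
  refine (encard_le_encard_of_injOn (f := fun i : Σ w : W, ι w => i.1.1)
    (t := {w ∈ W | f ⟨x, hx⟩ ∈ w}) ?_ ?_).trans (hWn (f ⟨x, hx⟩))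
  · rintro ⟨w, j⟩ hi
    exact ⟨w.2, (hAiff w ⟨x, hx⟩).1 hi.1⟩
  · rintro ⟨w, j⟩ hi ⟨w', j'⟩ hi' h
    obtain rfl : w = w' := Subtype.ext h
    obtain rfl : j = j' := hQd w j j' x hi.2 hi'.2
    rfl
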